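/- For $d\ge 1$ and $\ell\ge 0$ let $\mathrm{Harm}_\ell(\mathbb R^d)$ be the real vector space of polynomials $P\in\mathbb R[x_1,\dots,x_d]$ that are homogeneous of degree $\ell$ and satisfy $\Delta P=0$, where $\Delta=\sum_{a=1}^d \partial^2/\partial x_a^2$. The harmonic strength of a finite non-empty set $X\subset\mathbb R^d$ is $$T(X)=\Bigl\{\ell\in\mathbb Z_{\ge 0}\ :\ \sum_{x\in X}P(x)=0\ \text{ for all } P\in\mathrm{Harm}_\ell(\mathbb R^d)\Bigr\}$$ (the value $\ell=0$ never belongs to $T(X)$). Let $\mathbb H$ be Hamilton's quaternions with basis $1,i,j,k=ij$, identified with $\mathbb R^4$ by $x_1+x_2i+x_3j+x_4k\mapsto(x_1,x_2,x_3,x_4)$. Put $Q_8=\{\pm1,\pm i,\pm j,\pm k\}$, $$\tau=\frac{1+\sqrt5}{2},\qquad \omega=\frac{-1+i+j+k}{2},\qquad \alpha=\frac{1+i}{\sqrt2},\qquad \zeta=\frac{\tau+\tau^{-1}i+j}{2},$$ and, with $xS=\{xs : s\in S\}$, consider the binary tetrahedral, octahedral and icosahedral groups $$2T=Q_8\cup\omega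 Q_8\cup\omega^2Q_8,\qquad 2O=2T\cup\alpha\,2T,\qquad 2I=2T\cup\zeta\,2T\cup\zeta^2\,2T\cup\zeta^3\,2T\cup\zeta^4\,2T$$ of unit quaternions (of orders $24$, $48$ and $120$). **Theorem.** Let $\mathbb O^+$ denote the set of all positive odd integers. Then 1. $T(2T)=\{10,4,2\}\cup\mathbb O^+$; 2. $T(2O)=\{22,14,10,6,4,2\}\cup\mathbb O^+$; 3. $T(2I)=\{58,46,38,34,28,26,22,18,16,14,10,8,6,4,2\}\cup\mathbb O^+$. -/

import Mathlib

open scoped Quaternion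

noncomputable section

namespace HarmonicStrength

/-- The Laplacian `∂²/∂x₁² + ⋯ + ∂²/∂x_d²` on `ℝ[x₁, …, x_d]`. -/
def laplacian (d : ℕ) : MvPolynomial (Fin d) ℝ →ₗ[ℝ] MvPolynomial (Fin d) ℝ :=
  ∑ a : Fin d, (MvPolynomial.pderiv a).toLinearMap ∘ₗ (MvPolynomial.pderiv a).toLinearMap

/-- `Harm_ℓ(ℝ^d)`: the harmonic polynomials in `d` variables that are homogeneous of degree `ℓ`. -/
def Harm (d l : ℕ) : Submodule ℝ (MvPolynomial (Fin d) ℝ) :=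
  MvPolynomial.homogeneousSubmodule (Fin d) ℝ l ⊓ LinearMap.ker (laplacian d)

/-- The harmonic strength `T(X)` of a finite subset `X` of `ℝ^d`: all `ℓ` such that
`∑_{x ∈ X} P(x) = 0` for every harmonic polynomial `P` of homogeneous degree `ℓ`.
The value `ℓ = 0` is allowed here; it never belongs to `T(X)` when `X` is non-empty. -/
def T {d : ℕ} (X : Finset (Fin d → ℝ)) : Set ℕ :=
  {l | ∀ P ∈ Harm d l, ∑ x ∈ X, MvPolynomial.eval x P = 0}

/-- The set of positive odd integers. -/
def oddPos : Set ℕ := {n | Odd n}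

/-- A finite set of quaternions as a subset of `ℝ⁴`, via
`x₁ + x₂ i + x₃ j + x₄ k ↦ (x₁, x₂, x₃, x₄)`. -/
def toR4 (X : Finset ℍ[ℝ]) : Finset (Fin 4 → ℝ) :=
  X.map (Quaternion.equivTuple ℝ).toEmbedding

/-- The quaternion unit `i`. -/
def qi : ℍ[ℝ] := ⟨0, 1, 0, 0⟩
/-- The quaternion unit `j`. -/
def qj : ℍ[ℝ] := ⟨0, 0, 1, 0⟩
/-- The quaternion unit `k = ij`. -/
def qk : ℍ[ℝ] := ⟨0, 0, 0, 1⟩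

/-- `ω = (-1 + i + j + k) / 2`. -/
def omega : ℍ[ℝ] := ⟨-1 / 2, 1 / 2, 1 / 2, 1 / 2⟩

/-- `α = (1 + i) / √2`. -/
def alpha : ℍ[ℝ] := ⟨1 / √2, 1 / √2, 0, 0⟩

/-- `τ = (1 + √5) / 2`. -/
def tau : ℝ := (1 + √5) / 2

/-- `ζ = (τ + τ⁻¹ i + j) / 2`. -/
def zeta : ℍ[ℝ] := ⟨tau / 2, tau⁻¹ / 2, 1 / 2, 0⟩

open Classical in
/-- The translate `xS = {xε | ε ∈ S}`. -/
def translate (x : ℍ[ℝ]) (S : Finset ℍ[ℝ]) : Finset ℍ[ℝ] := S.image (fun e => x * e)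

open Classical in
/-- The quaternion group `{±1, ±i, ±j, ±k}`. -/
def Q8 : Finset ℍ[ℝ] := {1, -1, qi, -qi, qj, -qj, qk, -qk}

open Classical in
/-- The binary tetrahedral group `2T`, of order 24. -/
def binaryTetrahedral : Finset ℍ[ℝ] := Q8 ∪ translate omega Q8 ∪ translate (omega ^ 2) Q8

open Classical in
/-- The binary octahedral group `2O`, of order 48. -/
def binaryOctahedral : Finset ℍ[ℝ] := binaryTetrahedral ∪ translate alpha binaryTetrahedral

open Classical in
/-- The binary icosahedral group `2I`, of order 120. -/
def binaryIcosahedral : Finset ℍ[ℝ] :=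
  binaryTetrahedral ∪ translate zeta binaryTetrahedral ∪ translate (zeta ^ 2) binaryTetrahedral ∪
    translate (zeta ^ 3) binaryTetrahedral ∪ translate (zeta ^ 4) binaryTetrahedral

end HarmonicStrength

end

/-! For the Fischer product P(∂)Q(0), evaluation at a unit vector x on `Harm 4 n` is represented, up
to the factor 2ⁿ n!, by the zonal polynomial |y|ⁿ Uₙ(x·y/|y|), which is harmonic because d = 4. So P
↦ ∑ P(x) is represented by a multiple of F = ∑ `zonal x n`. As the product is definite, this
functional vanishes iff ⟨F, F⟩ = 0, i.e. iff the double sum of Uₙ(x·y) is zero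
(`mem_T_iff_sum_chebU`). In a group G of unit quaternions x·y is the real part of x⁻¹y, so the
condition collapses to ∑ Uₙ(Re g) = 0 over g ∈ G (`IsUnitGroup.mem_T_iff`).

For odd n the terms of g and -g cancel. For n = 2m the term depends only on s = 4(Re g)² and m. It
is 2m + 1 at g = ±1 and periodic in m at the other values of s that occur, so the condition is 2m +
1 = (a bounded periodic integer), a finite problem in the residues of m. What remains is to show
that the three sets are groups and to count their real parts, both coset by coset. -/

namespace HarmonicStrength

noncomputable section

open MvPolynomial

/-! ### The Fischer inner product on polynomials. -/

section Fischer

variable {σ : Type*}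

/-- The Fischer pairing `⟨P, Q⟩ = P(∂) Q` evaluated at `0`, for which the monomials are orthogonal
and `⟨x^m, x^m⟩ = m!`. -/
def fischer : MvPolynomial σ ℝ →ₗ[ℝ] MvPolynomial σ ℝ →ₗ[ℝ] ℝ :=
  (basisMonomials σ ℝ).constr ℝ fun m => (m.prod fun _ k => (k.factorial : ℝ)) • lcoeff ℝ m

lemma fischer_monomial (m : σ →₀ ℕ) (c : ℝ) (Q : MvPolynomial σ ℝ) :
    fischer (monomial m c) Q = c * ((m.prod fun _ k => (k.factorial : ℝ)) * coeff m Q) := by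
  have h : fischer (monomial m 1) = (m.prod fun _ k => (k.factorial : ℝ)) • lcoeff ℝ m := by
    have := (basisMonomials σ ℝ).constr_basis ℝ
      (fun m => (m.prod fun _ k => (k.factorial : ℝ)) • lcoeff ℝ m) m
    rwa [coe_basisMonomials] at this
  have hc : monomial m c = c • (monomial m 1 : MvPolynomial σ ℝ) := by simp [smul_monomial]
  rw [hc, map_smul, h]
  simp [lcoeff_apply]

/-- The weight m! is chosen for this adjointness: raising the exponent of `a` multiplies m! by m a +
1, the factor that differentiation produces. -/
lemma fischer_X_mul (a : σ) (P Q : MvPolynomial σ ℝ) :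
    fischer (X a * P) Q = fischer P (pderiv a Q) := by
  classical
  induction P using MvPolynomial.induction_on' with
  | add p q hp hq => simp [mul_add, hp, hq]
  | monomial m c =>
    have hX : X a * monomial m c = monomial (m + Finsupp.single a 1) c := by
      rw [X, monomial_mul, one_mul, add_comm]
    have hprod : ((m + Finsupp.single a 1).prod fun _ k => (k.factorial : ℝ)) =
        (m a + 1) * m.prod fun _ k => (k.factorial : ℝ) := by
      -- `a` may lie outside the support of `m`, so both products are extended to a common index
      -- set.
      set s := insert a m.support with hs
      have h1 : (m + Finsupp.single a 1).support ⊆ s := by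
        intro x hx
        by_cases hxa : x = a
        · simp [hs, hxa]
        · simp only [hs, Finset.mem_insert, Finsupp.mem_support_iff] at hx ⊢
          right
          simpa [Finsupp.single_apply, Ne.symm hxa] using hx
      rw [Finsupp.prod_of_support_subset _ h1 _ (by simp),
        Finsupp.prod_of_support_subset m (Finset.subset_insert _ _) _ (by simp), ← hs,
        ← Finset.mul_prod_erase s _ (Finset.mem_insert_self a _),
        ← Finset.mul_prod_erase s (fun x => ((m x).factorial : ℝ)) (Finset.mem_insert_self a _),
        ← mul_assoc]
      congr 1
      · simp [Nat.factorial_succ]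
      · refine Finset.prod_congr rfl fun x hx => ?_
        simp [(Finset.ne_of_mem_erase hx).symm]
    rw [hX, fischer_monomial, fischer_monomial, coeff_pderiv, hprod]
    ring

/-- The pairing is diagonal in the monomials with positive weights, hence definite. -/
lemma fischer_self_eq_zero {P : MvPolynomial σ ℝ} (h : fischer P P = 0) : P = 0 := by
  have hsum : fischer P P =
      ∑ m ∈ P.support, (m.prod fun _ k => (k.factorial : ℝ)) * coeff m P ^ 2 := by
    conv_lhs => enter [1, 2]; rw [P.as_sum]
    rw [map_sum, LinearMap.sum_apply]
    refine Finset.sum_congr rfl fun m _ => ?_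
    rw [fischer_monomial]
    ring
  have hpos : ∀ m : σ →₀ ℕ, 0 < m.prod fun _ k => (k.factorial : ℝ) := fun m =>
    Finset.prod_pos fun _ _ => Nat.cast_pos.2 (Nat.factorial_pos _)
  rw [hsum, Finset.sum_eq_zero_iff_of_nonneg fun m _ => mul_nonneg (hpos m).le (sq_nonneg _)] at h
  by_contra hP
  obtain ⟨m, hm⟩ := support_nonempty.2 hP
  have := h m hm
  rw [mul_eq_zero, sq_eq_zero_iff] at this
  exact this.elim (hpos m).ne' (mem_support_iff.1 hm)

end Fischer

/-! ### Zonal harmonics as reproducing kernels, and the Chebyshev criterion. -/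

section Zonal

variable {d : ℕ}

/-- The linear form `y ↦ x ⬝ y`. -/
def linForm (x : Fin d → ℝ) : MvPolynomial (Fin d) ℝ := ∑ a, C (x a) * X a

variable (d) in
/-- The quadratic form `y ↦ |y|²`. -/
def normForm : MvPolynomial (Fin d) ℝ := ∑ a, X a ^ 2

/-- The derivative in the direction `x`. -/
def dirDeriv (x : Fin d → ℝ) (P : MvPolynomial (Fin d) ℝ) : MvPolynomial (Fin d) ℝ :=
  ∑ a, C (x a) * pderiv a P

lemma laplacian_apply (P : MvPolynomial (Fin d) ℝ) :
    laplacian d P = ∑ a, pderiv a (pderiv a P) := by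
  simp [laplacian, LinearMap.sum_apply]

lemma C_two : (C 2 : MvPolynomial (Fin d) ℝ) = 2 := map_ofNat C 2

lemma pderiv_two (a : Fin d) : pderiv a (2 : MvPolynomial (Fin d) ℝ) = 0 :=
  (pderiv a).map_natCast 2

lemma dirDeriv_two (x : Fin d → ℝ) : dirDeriv x 2 = 0 := by
  simp [dirDeriv, pderiv_two]

lemma pderiv_linForm (x : Fin d → ℝ) (a : Fin d) : pderiv a (linForm x) = C (x a) := by
  simp [linForm, pderiv_X, Pi.single_apply, Derivation.leibniz]

lemma pderiv_normForm (a : Fin d) : pderiv a (normForm d) = 2 * X a := by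
  simp [normForm, pderiv_X, Pi.single_apply, Derivation.leibniz_pow]

lemma fischer_linForm_mul (x : Fin d → ℝ) (P Q : MvPolynomial (Fin d) ℝ) :
    fischer (linForm x * P) Q = fischer P (dirDeriv x Q) := by
  simp only [linForm, dirDeriv, Finset.sum_mul, map_sum, LinearMap.sum_apply, C_mul',
    map_smul]
  simp [fischer_X_mul]

lemma fischer_normForm_mul (P Q : MvPolynomial (Fin d) ℝ) :
    fischer (normForm d * P) Q = fischer P (laplacian d Q) := by
  simp only [normForm, laplacian_apply, Finset.sum_mul, map_sum, LinearMap.sum_apply, pow_two,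
    mul_assoc, fischer_X_mul]

lemma isHomogeneous_pderiv {P : MvPolynomial (Fin d) ℝ} {n : ℕ} (h : P.IsHomogeneous (n + 1))
    (a : Fin d) : (pderiv a P).IsHomogeneous n := h.pderiv

lemma isHomogeneous_dirDeriv {P : MvPolynomial (Fin d) ℝ} {n : ℕ} (h : P.IsHomogeneous (n + 1))
    (x : Fin d → ℝ) : (dirDeriv x P).IsHomogeneous n :=
  IsHomogeneous.sum _ _ _ fun a _ => by
    simpa using (isHomogeneous_C _ (x a)).mul (isHomogeneous_pderiv h a)

lemma eval_dirDeriv_self {P : MvPolynomial (Fin d) ℝ} {n : ℕ} (h : P.IsHomogeneous n)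
    (x : Fin d → ℝ) : eval x (dirDeriv x P) = n * eval x P := by
  have := congrArg (eval x) h.sum_X_mul_pderiv
  simpa [dirDeriv] using this

/-- Each factor `linForm x` moves across as a derivative along x, and Euler's identity at x
contributes the successive factors of n!. -/
lemma fischer_linForm_pow (x : Fin d → ℝ) {n : ℕ} {P : MvPolynomial (Fin d) ℝ}
    (h : P.IsHomogeneous n) : fischer (linForm x ^ n) P = n.factorial * eval x P := by
  induction n generalizing P with
  | zero =>
    obtain ⟨c, rfl⟩ : ∃ c, P = C c := 
      ⟨_, totalDegree_eq_zero_iff_eq_C.1 (Nat.le_zero.1 h.totalDegree_le)⟩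
    have := fischer_monomial (0 : Fin d →₀ ℕ) 1 (C c)
    simpa using this
  | succ n ih =>
    rw [pow_succ', fischer_linForm_mul, ih (isHomogeneous_dirDeriv h x), eval_dirDeriv_self h,
      Nat.factorial_succ]
    push_cast
    ring

lemma laplacian_mul (P Q : MvPolynomial (Fin d) ℝ) :
    laplacian d (P * Q) =
      P * laplacian d Q + Q * laplacian d P + 2 * ∑ a, pderiv a P * pderiv a Q := by
  simp only [laplacian_apply, Finset.mul_sum, ← Finset.sum_add_distrib]
  refine Finset.sum_congr rfl fun a _ => ?_
  simp only [Derivation.leibniz, smul_eq_mul, map_add]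
  ring

lemma laplacian_linForm_mul (x : Fin d → ℝ) (P : MvPolynomial (Fin d) ℝ) :
    laplacian d (linForm x * P) = linForm x * laplacian d P + 2 * dirDeriv x P := by
  have h : laplacian d (linForm x) = 0 := by simp [laplacian_apply, pderiv_linForm]
  simp [laplacian_mul, h, pderiv_linForm, dirDeriv]

/-- The 2d is Δ|y|²; the 4n is the cross term, by Euler's identity. -/
lemma laplacian_normForm_mul {P : MvPolynomial (Fin d) ℝ} {n : ℕ} (hP : P.IsHomogeneous n) :
    laplacian d (normForm d * P) =
      normForm d * laplacian d P + (2 * d + 4 * n : ℝ) • P := by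
  have h : laplacian d (normForm d) = (2 * d : ℝ) • 1 := by
    simp [laplacian_apply, pderiv_normForm, Derivation.leibniz, pderiv_two, smul_eq_C_mul, C_two,
      mul_comm]
  have he := hP.sum_X_mul_pderiv
  rw [laplacian_mul, h]
  simp only [pderiv_normForm, mul_assoc, ← Finset.mul_sum, he]
  simp only [smul_eq_C_mul, nsmul_eq_mul, map_add, map_mul, map_natCast, map_ofNat]
  ring

lemma dirDeriv_mul (x : Fin d → ℝ) (P Q : MvPolynomial (Fin d) ℝ) :
    dirDeriv x (P * Q) = P * dirDeriv x Q + Q * dirDeriv x P := by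
  simp only [dirDeriv, Finset.mul_sum, ← Finset.sum_add_distrib]
  refine Finset.sum_congr rfl fun a _ => ?_
  simp only [Derivation.leibniz, smul_eq_mul]
  ring

lemma dirDeriv_sub (x : Fin d → ℝ) (P Q : MvPolynomial (Fin d) ℝ) :
    dirDeriv x (P - Q) = dirDeriv x P - dirDeriv x Q := by
  simp [dirDeriv, mul_sub]

lemma dirDeriv_linForm_self {x : Fin d → ℝ} (hx : ∑ a, x a ^ 2 = 1) :
    dirDeriv x (linForm x) = 1 := by
  simp only [dirDeriv, pderiv_linForm, ← pow_two]
  simp only [← map_pow, ← map_sum, hx, map_one]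

lemma dirDeriv_normForm (x : Fin d → ℝ) : dirDeriv x (normForm d) = 2 * linForm x := by
  simp only [dirDeriv, pderiv_normForm, linForm, Finset.mul_sum]
  exact Finset.sum_congr rfl fun a _ => by ring

/-- The zonal polynomial of degree `n` with pole `x`: `|y|ⁿ Uₙ(x ⬝ y / |y|)`, for the Chebyshev
polynomial `Uₙ` of the second kind. -/
def zonal (x : Fin d → ℝ) : ℕ → MvPolynomial (Fin d) ℝ
  | 0 => 1
  | 1 => 2 * linForm x
  | n + 2 => 2 * linForm x * zonal x (n + 1) - normForm d * zonal x n

lemma isHomogeneous_two_mul_linForm (x : Fin d → ℝ) : (2 * linForm x).IsHomogeneous 1 := by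
  rw [linForm, Finset.mul_sum]
  refine IsHomogeneous.sum _ _ _ fun a _ => ?_
  have := (isHomogeneous_C (Fin d) (2 * x a)).mul (isHomogeneous_X ℝ a)
  simpa [mul_assoc, C_two] using this

lemma isHomogeneous_normForm : (normForm d).IsHomogeneous 2 :=
  IsHomogeneous.sum _ _ _ fun a _ => by simpa using (isHomogeneous_X ℝ a).pow 2

lemma isHomogeneous_zonal (x : Fin d → ℝ) : ∀ n, (zonal x n).IsHomogeneous n
  | 0 => isHomogeneous_one _ _
  | 1 => isHomogeneous_two_mul_linForm x
  | n + 2 => by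
    rw [zonal]
    refine IsHomogeneous.sub ?_ ?_
    · have := (isHomogeneous_two_mul_linForm x).mul (isHomogeneous_zonal x (n + 1))
      rwa [show 1 + (n + 1) = n + 2 by ring] at this
    · have := isHomogeneous_normForm.mul (isHomogeneous_zonal x n)
      rwa [add_comm] at this

lemma dirDeriv_zonal {x : Fin d → ℝ} (hx : ∑ a, x a ^ 2 = 1) :
    ∀ n : ℕ, dirDeriv x (zonal x (n + 1)) = (n + 2 : ℝ) • zonal x n
  | 0 => by
    simp [zonal, dirDeriv_mul, dirDeriv_linForm_self hx, dirDeriv_two, smul_eq_C_mul, C_two]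
  | 1 => by
    have h1 : dirDeriv x (1 : MvPolynomial (Fin d) ℝ) = 0 := by
      simp [dirDeriv]
    simp only [zonal, dirDeriv_sub, dirDeriv_mul, dirDeriv_linForm_self hx, dirDeriv_two, h1,
      dirDeriv_normForm, smul_eq_C_mul, Nat.cast_one, map_add, map_one, map_ofNat]
    ring
  | n + 2 => by
    have e : zonal x (n + 2) = 2 * linForm x * zonal x (n + 1) - normForm d * zonal x n := by
      rw [zonal]
    rw [zonal, dirDeriv_sub, dirDeriv_mul, dirDeriv_mul, dirDeriv_mul, dirDeriv_linForm_self hx,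
      dirDeriv_two, dirDeriv_normForm, dirDeriv_zonal hx (n + 1), dirDeriv_zonal hx n]
    simp only [smul_eq_C_mul, Nat.cast_add, Nat.cast_one, Nat.cast_ofNat, map_add, map_one,
      map_ofNat, map_natCast]
    -- Besides 2 `zonal x (n + 2)`, the product rule leaves n + 2 copies of the right side of `e`.
    linear_combination (-(n + 2) : MvPolynomial (Fin d) ℝ) * e

/-- Dimension 4 enters here: in the recursion the first product contributes 4(n + 2) `zonal x n` by
`dirDeriv_zonal`, the second (2·4 + 4n) `zonal x n`, and these cancel. -/
lemma laplacian_zonal {x : Fin 4 → ℝ} (hx : ∑ a, x a ^ 2 = 1) :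
    ∀ n, laplacian 4 (zonal x n) = 0
  | 0 => by simp [zonal, laplacian_apply]
  | 1 => by
    have h := laplacian_linForm_mul x 2
    rw [zonal, mul_comm, h]
    simp [laplacian_apply, pderiv_two, dirDeriv_two]
  | n + 2 => by
    rw [zonal, map_sub, laplacian_normForm_mul (isHomogeneous_zonal x n), laplacian_zonal hx n,
      mul_comm 2 (linForm x), mul_assoc, laplacian_linForm_mul, dirDeriv_mul, dirDeriv_two,
      dirDeriv_zonal hx, two_mul (zonal x (n + 1)), map_add, laplacian_zonal hx (n + 1)]
    simp only [smul_eq_C_mul, Nat.cast_ofNat, map_add, map_mul,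
      map_ofNat, map_natCast]
    ring

lemma zonal_mem_Harm {x : Fin 4 → ℝ} (hx : ∑ a, x a ^ 2 = 1) (n : ℕ) : zonal x n ∈ Harm 4 n :=
  ⟨isHomogeneous_zonal x n, laplacian_zonal hx n⟩

/-- Multiplication by |y|² is adjoint to the Laplacian, so only the leading term pairs nontrivially
with harmonic polynomials; this yields the reproducing property `fischer_zonal`. -/
lemma zonal_eq_linForm_pow_add (x : Fin d → ℝ) :
    ∀ n, ∃ R, zonal x n = (2 : ℝ) ^ n • linForm x ^ n + normForm d * R
  | 0 => ⟨0, by simp [zonal]⟩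
  | 1 => ⟨0, by simp [zonal, smul_eq_C_mul, C_two]⟩
  | n + 2 => by
    obtain ⟨R, hR⟩ := zonal_eq_linForm_pow_add x (n + 1)
    refine ⟨2 * linForm x * R - zonal x n, ?_⟩
    rw [zonal, hR]
    simp only [smul_eq_C_mul, map_pow, map_ofNat]
    ring

lemma fischer_zonal (x : Fin d → ℝ) {n : ℕ} {P : MvPolynomial (Fin d) ℝ} (hP : P ∈ Harm d n) :
    fischer (zonal x n) P = 2 ^ n * n.factorial * eval x P := by
  obtain ⟨R, hR⟩ := zonal_eq_linForm_pow_add x n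
  have h0 : laplacian d P = 0 := hP.2
  rw [hR, map_add, LinearMap.add_apply, fischer_normForm_mul, h0, map_smul, LinearMap.smul_apply,
    fischer_linForm_pow x hP.1]
  simp [mul_assoc]

/-- The values `Uₙ(t)` of the Chebyshev polynomials of the second kind. -/
def chebU (t : ℝ) : ℕ → ℝ
  | 0 => 1
  | 1 => 2 * t
  | n + 2 => 2 * t * chebU t (n + 1) - chebU t n

lemma eval_zonal (x : Fin d → ℝ) {y : Fin d → ℝ} (hy : ∑ a, y a ^ 2 = 1) :
    ∀ n, eval y (zonal x n) = chebU (∑ a, x a * y a) n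
  | 0 => by simp [zonal, chebU]
  | 1 => by simp [zonal, chebU, linForm]
  | n + 2 => by
    rw [zonal, chebU, ← eval_zonal x hy n, ← eval_zonal x hy (n + 1)]
    simp [linForm, normForm, hy]

/-- A finite set on the unit sphere of `ℝ⁴` has `n` in its harmonic strength if and only if
the sum of `Uₙ` over all inner products vanishes. -/
theorem mem_T_iff_sum_chebU {X : Finset (Fin 4 → ℝ)} (hX : ∀ x ∈ X, ∑ a, x a ^ 2 = 1) (n : ℕ) :
    n ∈ T X ↔ ∑ x ∈ X, ∑ y ∈ X, chebU (∑ a, x a * y a) n = 0 := by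
  have key : ∀ x, ∑ y ∈ X, chebU (∑ a, x a * y a) n = ∑ y ∈ X, eval y (zonal x n) := fun x =>
    Finset.sum_congr rfl fun y hy => (eval_zonal x (hX y hy) n).symm
  simp only [key]
  constructor
  · intro h
    exact Finset.sum_eq_zero fun x hx => h _ (zonal_mem_Harm (hX x hx) n)
  · intro h P hP
    have hc : (2 ^ n * n.factorial : ℝ) ≠ 0 := by positivity
    have hF : ∀ Q ∈ Harm 4 n, fischer (∑ x ∈ X, zonal x n) Q =
        2 ^ n * n.factorial * ∑ x ∈ X, eval x Q := fun Q hQ => by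
      rw [map_sum, LinearMap.sum_apply, Finset.mul_sum]
      exact Finset.sum_congr rfl fun x _ => fischer_zonal x hQ
    have hFmem : ∑ x ∈ X, zonal x n ∈ Harm 4 n :=
      Submodule.sum_mem _ fun x hx => zonal_mem_Harm (hX x hx) n
    -- The sum is itself harmonic, so `hF` applies to it and its Fischer square is a multiple of the
    -- double sum.
    have h0 : ∑ x ∈ X, zonal x n = 0 := by
      refine fischer_self_eq_zero ?_
      rw [hF _ hFmem, Finset.sum_congr rfl fun y _ => map_sum (eval y) _ _, Finset.sum_comm, h,
        mul_zero]
    have := hF P hP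
    rw [h0, map_zero, LinearMap.zero_apply, eq_comm, mul_eq_zero] at this
    exact this.resolve_left hc

end Zonal

/-! ### Reduction to a single sum for groups of unit quaternions. -/

section Unit

/-- A finite submonoid (hence subgroup) of the group of unit quaternions. -/
structure IsUnitGroup (G : Finset ℍ[ℝ]) : Prop where
  one_mem : 1 ∈ G
  mul_mem : ∀ x ∈ G, ∀ y ∈ G, x * y ∈ G
  star_mul_self : ∀ x ∈ G, star x * x = 1

variable {G : Finset ℍ[ℝ]}

lemma IsUnitGroup.ne_zero (hG : IsUnitGroup G) {x : ℍ[ℝ]} (hx : x ∈ G) : x ≠ 0 := by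
  rintro rfl
  simpa using hG.star_mul_self 0 hx

lemma IsUnitGroup.mul_star_self (hG : IsUnitGroup G) {x : ℍ[ℝ]} (hx : x ∈ G) : x * star x = 1 :=
  mul_eq_one_comm.1 (hG.star_mul_self x hx)

/-- Left multiplication by x is injective on the finite set G, hence reaches 1. -/
lemma IsUnitGroup.star_mem (hG : IsUnitGroup G) {x : ℍ[ℝ]} (hx : x ∈ G) : star x ∈ G := by
  have hinj : Set.InjOn (fun y => x * y) (G : Set ℍ[ℝ]) := fun y _ z _ h =>
    mul_left_cancel₀ (hG.ne_zero hx) h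
  obtain ⟨y, hy, hxy⟩ := Finset.surj_on_of_inj_on_of_card_le (s := G) (t := G) (fun y _ => x * y)
    (fun y hy => hG.mul_mem x hx y hy) (fun y z hy hz h => hinj hy hz h) le_rfl 1 hG.one_mem
  have : star x = y := by
    rw [← mul_one (star x), hxy, ← mul_assoc, hG.star_mul_self x hx, one_mul]
  exact this ▸ hy

lemma sum_sq_equivTuple (x : ℍ[ℝ]) :
    ∑ a, Quaternion.equivTuple ℝ x a ^ 2 = (star x * x).re := by
  simp [Fin.sum_univ_four, Quaternion.equivTuple_apply]
  ring

lemma sum_mul_equivTuple (x y : ℍ[ℝ]) :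
    ∑ a, Quaternion.equivTuple ℝ x a * Quaternion.equivTuple ℝ y a = (star x * y).re := by
  simp [Fin.sum_univ_four, Quaternion.equivTuple_apply]

/-- The substitution y ↦ x⁻¹y permutes G, so every row of the double sum has the same value. -/
theorem IsUnitGroup.mem_T_iff (hG : IsUnitGroup G) (n : ℕ) :
    n ∈ T (toR4 G) ↔ ∑ g ∈ G, chebU g.re n = 0 := by
  have hunit : ∀ x ∈ toR4 G, ∑ a, x a ^ 2 = 1 := by
    intro x hx
    obtain ⟨g, hg, rfl⟩ := Finset.mem_map.1 hx
    exact (sum_sq_equivTuple g).trans (by simp [hG.star_mul_self g hg])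
  have hinner : ∀ x ∈ G, ∑ y ∈ G, chebU (star x * y).re n = ∑ y ∈ G, chebU y.re n := by
    intro x hx
    refine Finset.sum_nbij' (fun y => star x * y) (fun y => x * y)
      (fun y hy => hG.mul_mem _ (hG.star_mem hx) _ hy) (fun y hy => hG.mul_mem _ hx _ hy)
      (fun y _ => ?_) (fun y _ => ?_) fun _ _ => rfl
    · rw [← mul_assoc, hG.mul_star_self hx, one_mul]
    · rw [← mul_assoc, hG.star_mul_self x hx, one_mul]
  have hcard : (G.card : ℝ) ≠ 0 := by
    exact_mod_cast (Finset.card_pos.2 ⟨1, hG.one_mem⟩).ne'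
  rw [mem_T_iff_sum_chebU hunit]
  simp only [toR4, Finset.sum_map, Equiv.coe_toEmbedding, sum_mul_equivTuple]
  rw [Finset.sum_congr rfl hinner, Finset.sum_const, nsmul_eq_mul, mul_eq_zero,
    or_iff_right hcard]

lemma chebU_neg (t : ℝ) : ∀ n, chebU (-t) n = (-1) ^ n * chebU t n
  | 0 => by simp [chebU]
  | 1 => by simp [chebU]
  | n + 2 => by
    rw [chebU, chebU, chebU_neg t n, chebU_neg t (n + 1)]
    ring

lemma IsUnitGroup.mem_T_of_odd (hG : IsUnitGroup G) (hneg : -1 ∈ G) {n : ℕ} (hn : Odd n) :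
    n ∈ T (toR4 G) := by
  rw [hG.mem_T_iff]
  have hmem : ∀ g ∈ G, -g ∈ G := fun g hg => by simpa using hG.mul_mem _ hneg _ hg
  have h : ∑ g ∈ G, chebU g.re n = ∑ g ∈ G, -chebU g.re n := by
    refine Finset.sum_nbij' (fun g => -g) (fun g => -g) hmem hmem (by simp) (by simp) fun g _ => ?_
    rw [Quaternion.re_neg, chebU_neg, hn.neg_one_pow]
    ring
  rw [Finset.sum_neg_distrib] at h
  linarith

end Unit

/-! ### Even-index Chebyshev values at the squared traces that occur. -/

section EvenU

/-- The polynomial `s ↦ evenU s n` with `U₂ₙ(t) = evenU (4 t²) n`. -/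
def evenU (s : ℝ) : ℕ → ℝ
  | 0 => 1
  | 1 => s - 1
  | n + 2 => (s - 2) * evenU s (n + 1) - evenU s n

/-- Eliminating the odd-index terms gives the two-step recursion with coefficient 4t² - 2. -/
lemma chebU_two_mul (t : ℝ) : ∀ n, chebU t (2 * n) = evenU ((2 * t) ^ 2) n
  | 0 => by simp [chebU, evenU]
  | 1 => by simp [chebU, evenU]; ring
  | n + 2 => by
    rw [evenU, ← chebU_two_mul t n, ← chebU_two_mul t (n + 1),
      show 2 * (n + 2) = 2 * n + 2 + 2 by ring, show 2 * (n + 1) = 2 * n + 2 by ring, chebU,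
      show chebU t (2 * n + 2 + 1) = 2 * t * chebU t (2 * n + 2) - chebU t (2 * n + 1) from rfl]
    have h : chebU t (2 * n + 2) = 2 * t * chebU t (2 * n + 1) - chebU t (2 * n) := rfl
    linear_combination h

/-- The recursion has order two, so the return of both initial values forces periodicity. -/
lemma evenU_periodic {s : ℝ} {p : ℕ} (h0 : evenU s p = 1) (h1 : evenU s (p + 1) = s - 1) :
    Function.Periodic (evenU s) p := by
  have h : ∀ n, evenU s (n + p) = evenU s n ∧ evenU s (n + 1 + p) = evenU s (n + 1) := by
    intro n
    induction n with
    | zero => exact ⟨by rw [zero_add, h0, evenU], by rw [zero_add, add_comm, h1, evenU]⟩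
    | succ n ih =>
      refine ⟨ih.2, ?_⟩
      rw [show n + 1 + 1 + p = n + p + 2 by ring, evenU, show n + p + 1 = n + 1 + p by ring,
        ih.1, ih.2, show n + 1 + 1 = n + 2 from rfl, evenU]
  exact fun n => (h n).1

lemma evenU_four : ∀ n : ℕ, evenU 4 n = 2 * n + 1
  | 0 => by simp [evenU]
  | 1 => by norm_num [evenU]
  | n + 2 => by
    rw [evenU, evenU_four n, evenU_four (n + 1)]
    push_cast
    ring

/-- Integer casts let `norm_cast` turn the final equations into integer arithmetic. -/
lemma evenU_zero (n : ℕ) : evenU 0 n = (if n % 2 = 0 then 1 else -1 : ℤ) := by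
  rw [← (evenU_periodic (s := 0) (p := 2) (by norm_num [evenU]) (by norm_num [evenU])).map_mod_nat n]
  have := Nat.mod_lt n (show 2 > 0 by norm_num)
  interval_cases n % 2 <;> norm_num [evenU]

lemma evenU_one (n : ℕ) :
    evenU 1 n = (if n % 3 = 0 then 1 else if n % 3 = 1 then 0 else -1 : ℤ) := by
  rw [← (evenU_periodic (s := 1) (p := 3) (by norm_num [evenU]) (by norm_num [evenU])).map_mod_nat n]
  have := Nat.mod_lt n (show 3 > 0 by norm_num)
  interval_cases n % 3 <;> norm_num [evenU]

lemma evenU_two (n : ℕ) : evenU 2 n = (if n % 4 < 2 then 1 else -1 : ℤ) := by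
  rw [← (evenU_periodic (s := 2) (p := 4) (by norm_num [evenU]) (by norm_num [evenU])).map_mod_nat n]
  have := Nat.mod_lt n (show 4 > 0 by norm_num)
  interval_cases n % 4 <;> norm_num [evenU]

lemma tau_sq : tau ^ 2 = tau + 1 := by
  have := Real.sq_sqrt (show (0 : ℝ) ≤ 5 by norm_num)
  rw [tau]
  linear_combination this / 4

lemma tau_inv : tau⁻¹ = tau - 1 := by
  have h : tau ≠ 0 := fun h => by simpa [h] using tau_sq
  field_simp
  linear_combination -tau_sq

lemma evenU_tau_periodic : Function.Periodic (evenU (tau + 1)) 5 := by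
  have h := tau_sq
  apply evenU_periodic
  · simp only [evenU]
    -- The coefficient is the quotient of the difference of the two sides by τ² - τ - 1.
    linear_combination (2 - 3 * tau ^ 2 + 1 * tau ^ 3) * h
  · simp only [evenU]
    linear_combination (-1 + 4 * tau + 2 * tau ^ 2 - 4 * tau ^ 3 + 1 * tau ^ 4) * h

lemma evenU_tau_conj_periodic : Function.Periodic (evenU (2 - tau)) 5 := by
  have h := tau_sq
  apply evenU_periodic
  · simp only [evenU]
    linear_combination (3 * tau - 1 * tau ^ 3) * h
  · simp only [evenU]
    linear_combination (2 - 4 * tau ^ 2 + 1 * tau ^ 4) * h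

/-- The squared traces τ² = τ + 1 and τ⁻² = 2 - τ are conjugate over ℚ, so the sum is rational
although the terms need not be. -/
lemma evenU_tau_add_conj (n : ℕ) :
    evenU (tau + 1) n + evenU (2 - tau) n =
      (if n % 5 = 0 then 2 else if n % 5 = 1 then 1 else if n % 5 = 2 then 0 else
        if n % 5 = 3 then -1 else -2 : ℤ) := by
  rw [← evenU_tau_periodic.map_mod_nat n, ← evenU_tau_conj_periodic.map_mod_nat n]
  have h := tau_sq
  have := Nat.mod_lt n (show 5 > 0 by norm_num)
  interval_cases n % 5 <;> norm_num only [evenU, if_true, if_false]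
  · ring
  · linear_combination 2 * h
  · linear_combination -h
  · linear_combination (2 * tau ^ 2 - 2 * tau - 3) * h

end EvenU

/-! ### Translates and left stabilizers. -/

lemma mem_translate {x y : ℍ[ℝ]} {S : Finset ℍ[ℝ]} :
    y ∈ translate x S ↔ ∃ s ∈ S, x * s = y := by
  simp [translate]

open Classical in
lemma sum_translate {x : ℍ[ℝ]} (hx : x ≠ 0) (S : Finset ℍ[ℝ]) (f : ℍ[ℝ] → ℝ) :
    ∑ y ∈ translate x S, f y = ∑ s ∈ S, f (x * s) := by
  rw [translate, Finset.sum_image fun a _ b _ h => mul_left_cancel₀ hx h]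

open Classical in
lemma translate_one (S : Finset ℍ[ℝ]) : translate 1 S = S := by
  simp [translate]

lemma IsUnitGroup.disjoint_translate {S : Finset ℍ[ℝ]} (hS : IsUnitGroup S) {x y : ℍ[ℝ]}
    (h : ∀ s ∈ S, x * s ≠ y) : Disjoint (translate x S) (translate y S) := by
  rw [Finset.disjoint_left]
  intro z hx hy
  obtain ⟨s, hs, rfl⟩ := mem_translate.1 hx
  obtain ⟨t, ht, hxy⟩ := mem_translate.1 hy
  refine h (s * star t) (hS.mul_mem _ hs _ (hS.star_mem ht)) ?_
  rw [← mul_assoc, ← hxy, mul_assoc, hS.mul_star_self ht, mul_one]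

/-- The quaternions `x` for which left multiplication by `x` maps `G` to itself. -/
def leftStabilizer (G : Finset ℍ[ℝ]) : Submonoid ℍ[ℝ] where
  carrier := {x | ∀ y ∈ G, x * y ∈ G}
  one_mem' := fun y hy => by rwa [one_mul]
  mul_mem' := fun {a b} ha hb y hy => by
    rw [mul_assoc]
    exact ha _ (hb _ hy)

lemma mem_leftStabilizer {G : Finset ℍ[ℝ]} {x : ℍ[ℝ]} :
    x ∈ leftStabilizer G ↔ ∀ y ∈ G, x * y ∈ G := Iff.rfl

/-! ### The quaternion group and sums over its cosets. -/

section Q8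

@[simp] lemma qi_re : qi.re = 0 := rfl
@[simp] lemma qi_imI : qi.imI = 1 := rfl
@[simp] lemma qi_imJ : qi.imJ = 0 := rfl
@[simp] lemma qi_imK : qi.imK = 0 := rfl

@[simp] lemma qj_re : qj.re = 0 := rfl
@[simp] lemma qj_imI : qj.imI = 0 := rfl
@[simp] lemma qj_imJ : qj.imJ = 1 := rfl
@[simp] lemma qj_imK : qj.imK = 0 := rfl

@[simp] lemma qk_re : qk.re = 0 := rfl
@[simp] lemma qk_imI : qk.imI = 0 := rfl
@[simp] lemma qk_imJ : qk.imJ = 0 := rfl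
@[simp] lemma qk_imK : qk.imK = 1 := rfl

lemma qi_mul_qi : qi * qi = -1 := by ext <;> simp
lemma qj_mul_qj : qj * qj = -1 := by ext <;> simp
lemma qi_mul_qj : qi * qj = qk := by ext <;> simp
lemma qj_mul_qi : qj * qi = -qk := by ext <;> simp
lemma qj_mul_qk : qj * qk = qi := by ext <;> simp
lemma qi_mul_qk : qi * qk = -qj := by ext <;> simp

lemma mem_Q8 {x : ℍ[ℝ]} : x ∈ Q8 ↔
    x = 1 ∨ x = -1 ∨ x = qi ∨ x = -qi ∨ x = qj ∨ x = -qj ∨ x = qk ∨ x = -qk := by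
  simp [Q8]

lemma neg_one_mem_Q8 : -1 ∈ Q8 := by simp [mem_Q8]
lemma qi_mem_Q8 : qi ∈ Q8 := by simp [mem_Q8]
lemma qj_mem_Q8 : qj ∈ Q8 := by simp [mem_Q8]
lemma qk_mem_Q8 : qk ∈ Q8 := by simp [mem_Q8]

/-- With M a left stabilizer, closure under multiplication reduces to the generators. -/
lemma Q8_subset {M : Submonoid ℍ[ℝ]} (hi : qi ∈ M) (hj : qj ∈ M) {x : ℍ[ℝ]} (hx : x ∈ Q8) :
    x ∈ M := by
  have hm : (-1 : ℍ[ℝ]) ∈ M := qi_mul_qi ▸ M.mul_mem hi hi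
  have hk : qk ∈ M := qi_mul_qj ▸ M.mul_mem hi hj
  have hneg : ∀ y ∈ M, -y ∈ M := fun y hy => by simpa using M.mul_mem hm hy
  rcases mem_Q8.1 hx with rfl | rfl | rfl | rfl | rfl | rfl | rfl | rfl
  exacts [M.one_mem, hm, hi, hneg _ hi, hj, hneg _ hj, hk, hneg _ hk]

lemma isUnitGroup_Q8 : IsUnitGroup Q8 where
  one_mem := by simp [mem_Q8]
  mul_mem := by
    intro x hx
    refine mem_leftStabilizer.1 (Q8_subset ?_ ?_ hx) <;> intro y hy <;>
      rcases mem_Q8.1 hy with rfl | rfl | rfl | rfl | rfl | rfl | rfl | rfl <;>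
      simp [mem_Q8, qi_mul_qi, qi_mul_qj, qi_mul_qk, qj_mul_qi, qj_mul_qj, qj_mul_qk]
  star_mul_self := by
    intro x hx
    rcases mem_Q8.1 hx with rfl | rfl | rfl | rfl | rfl | rfl | rfl | rfl <;>
      ext <;> simp

/-- The sum of `evenU` over the real parts of the coset `x Q₈`. -/
def cosetSum (x : ℍ[ℝ]) (n : ℕ) : ℝ :=
  2 * (evenU ((2 * x.re) ^ 2) n + evenU ((2 * x.imI) ^ 2) n + evenU ((2 * x.imJ) ^ 2) n +
    evenU ((2 * x.imK) ^ 2) n)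

-- The real parts over x Q₈ are ± the four coordinates of x, and even-index terms ignore the sign.
open Classical in
lemma sum_Q8 (x : ℍ[ℝ]) (n : ℕ) : ∑ q ∈ Q8, chebU (x * q).re (2 * n) = cosetSum x n := by
  have hd : ∀ a b : ℍ[ℝ], a = b ↔ a.re = b.re ∧ a.imI = b.imI ∧ a.imJ = b.imJ ∧ a.imK = b.imK :=
    fun a b => Quaternion.ext_iff
  rw [Q8]
  repeat rw [Finset.sum_insert (by
    simp only [Finset.mem_insert, Finset.mem_singleton, hd]; norm_num)]
  rw [Finset.sum_singleton]
  simp only [chebU_two_mul, cosetSum]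
  simp
  ring

lemma cosetSum_eq {x : ℍ[ℝ]} {a b c d : ℝ} (ha : (2 * x.re) ^ 2 = a) (hb : (2 * x.imI) ^ 2 = b)
    (hc : (2 * x.imJ) ^ 2 = c) (hd : (2 * x.imK) ^ 2 = d) (n : ℕ) :
    cosetSum x n = 2 * (evenU a n + evenU b n + evenU c n + evenU d n) := by
  rw [cosetSum, ha, hb, hc, hd]

end Q8

/-! ### The binary tetrahedral group. -/

section Tetrahedral

@[simp] lemma omega_re : omega.re = -1 / 2 := rfl
@[simp] lemma omega_imI : omega.imI = 1 / 2 := rfl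
@[simp] lemma omega_imJ : omega.imJ = 1 / 2 := rfl
@[simp] lemma omega_imK : omega.imK = 1 / 2 := rfl

lemma qi_mul_omega : qi * omega = omega * qj := by ext <;> norm_num
lemma qj_mul_omega : qj * omega = omega * qk := by ext <;> norm_num

@[simp] lemma omega_sq_re : (omega ^ 2).re = -1 / 2 := by norm_num [pow_two]
@[simp] lemma omega_sq_imI : (omega ^ 2).imI = -1 / 2 := by norm_num [pow_two]
@[simp] lemma omega_sq_imJ : (omega ^ 2).imJ = -1 / 2 := by norm_num [pow_two]
@[simp] lemma omega_sq_imK : (omega ^ 2).imK = -1 / 2 := by norm_num [pow_two]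

lemma omega_pow_three : omega ^ 3 = 1 := by
  rw [pow_succ]
  ext <;> simp <;> norm_num

lemma star_omega_mul_self : star omega * omega = 1 := by
  ext <;> simp <;> norm_num

lemma omega_ne_zero : omega ≠ 0 := fun h => by simpa [h] using star_omega_mul_self

lemma mem_binaryTetrahedral {x : ℍ[ℝ]} :
    x ∈ binaryTetrahedral ↔ ∃ a < 3, ∃ q ∈ Q8, omega ^ a * q = x := by
  simp only [binaryTetrahedral, Finset.mem_union, mem_translate]
  constructor
  · rintro ((h | ⟨q, hq, h⟩) | ⟨q, hq, h⟩)
    exacts [⟨0, by norm_num, x, h, by simp⟩, ⟨1, by norm_num, q, hq, by simpa using h⟩,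
      ⟨2, by norm_num, q, hq, h⟩]
  · rintro ⟨a, ha, q, hq, h⟩
    interval_cases a
    exacts [.inl (.inl (by simpa [← h] using hq)), .inl (.inr ⟨q, hq, by simpa using h⟩),
      .inr ⟨q, hq, h⟩]

lemma omega_pow_mul_mem {q : ℍ[ℝ]} (hq : q ∈ Q8) (a : ℕ) :
    omega ^ a * q ∈ binaryTetrahedral := by
  rw [← Nat.div_add_mod a 3, pow_add, pow_mul, omega_pow_three, one_pow, one_mul]
  exact mem_binaryTetrahedral.2 ⟨a % 3, Nat.mod_lt _ (by norm_num), q, hq, rfl⟩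

lemma Q8_subset_binaryTetrahedral {q : ℍ[ℝ]} (hq : q ∈ Q8) : q ∈ binaryTetrahedral := by
  simpa using omega_pow_mul_mem hq 0

lemma omega_mem_binaryTetrahedral : omega ∈ binaryTetrahedral := by
  simpa using omega_pow_mul_mem isUnitGroup_Q8.one_mem 1

/-- If conjugation by `ω` maps `q ∈ Q₈` to `q'`, `q'` to `q''`, then `q` stabilizes `2T`. -/
lemma mem_leftStabilizer_binaryTetrahedral {q q' q'' : ℍ[ℝ]} (h : q ∈ Q8) (h' : q' ∈ Q8)
    (h'' : q'' ∈ Q8) (e : q * omega = omega * q') (e' : q' * omega = omega * q'') :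
    q ∈ leftStabilizer binaryTetrahedral := by
  intro y hy
  obtain ⟨a, ha, p, hp, rfl⟩ := mem_binaryTetrahedral.1 hy
  interval_cases a
  · simpa using Q8_subset_binaryTetrahedral (isUnitGroup_Q8.mul_mem _ h _ hp)
  · rw [pow_one, ← mul_assoc, e, mul_assoc]
    simpa using omega_pow_mul_mem (isUnitGroup_Q8.mul_mem _ h' _ hp) 1
  · rw [pow_two, ← mul_assoc, ← mul_assoc, e, mul_assoc omega, e', ← mul_assoc, ← pow_two,
      mul_assoc]
    exact omega_pow_mul_mem (isUnitGroup_Q8.mul_mem _ h'' _ hp) 2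

lemma binaryTetrahedral_subset {M : Submonoid ℍ[ℝ]} (hi : qi ∈ M) (hω : omega ∈ M) {x : ℍ[ℝ]}
    (hx : x ∈ binaryTetrahedral) : x ∈ M := by
  have hj : qj ∈ M := by
    have : omega ^ 2 * qi * omega = qj := by
      rw [mul_assoc, qi_mul_omega, ← mul_assoc, ← pow_succ, omega_pow_three, one_mul]
    exact this ▸ M.mul_mem (M.mul_mem (M.pow_mem hω 2) hi) hω
  obtain ⟨a, -, q, hq, rfl⟩ := mem_binaryTetrahedral.1 hx
  exact M.mul_mem (M.pow_mem hω a) (Q8_subset hi hj hq)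

lemma star_mul_self_of_mul {x y : ℍ[ℝ]} (hx : star x * x = 1) (hy : star y * y = 1) :
    star (x * y) * (x * y) = 1 := by
  rw [star_mul, mul_assoc, ← mul_assoc (star x), hx, one_mul, hy]

/-- The submonoid of unit quaternions. -/
def unitQuaternions : Submonoid ℍ[ℝ] where
  carrier := {x | star x * x = 1}
  one_mem' := by simp
  mul_mem' := star_mul_self_of_mul

lemma mem_unitQuaternions {x : ℍ[ℝ]} : x ∈ unitQuaternions ↔ star x * x = 1 := Iff.rfl

lemma isUnitGroup_binaryTetrahedral : IsUnitGroup binaryTetrahedral where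
  one_mem := Q8_subset_binaryTetrahedral isUnitGroup_Q8.one_mem
  mul_mem := by
    intro x hx
    refine mem_leftStabilizer.1 (binaryTetrahedral_subset ?_ ?_ hx)
    · exact mem_leftStabilizer_binaryTetrahedral qi_mem_Q8 qj_mem_Q8 qk_mem_Q8 qi_mul_omega
        qj_mul_omega
    · intro y hy
      obtain ⟨a, -, q, hq, rfl⟩ := mem_binaryTetrahedral.1 hy
      rw [← mul_assoc, ← pow_succ']
      exact omega_pow_mul_mem hq _
  star_mul_self := fun x hx => mem_unitQuaternions.1 <| binaryTetrahedral_subset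
    (isUnitGroup_Q8.star_mul_self _ qi_mem_Q8) star_omega_mul_self hx

lemma sq_re_of_mem_Q8 {q : ℍ[ℝ]} (hq : q ∈ Q8) : (2 * q.re) ^ 2 = 0 ∨ (2 * q.re) ^ 2 = 4 := by
  rcases mem_Q8.1 hq with rfl | rfl | rfl | rfl | rfl | rfl | rfl | rfl <;> norm_num

/-- An obstruction to membership: α and ζᵏ for 0 < k < 5 have other squared traces, so their cosets
differ from 2T. -/
lemma sq_re_of_mem_binaryTetrahedral {x : ℍ[ℝ]} (hx : x ∈ binaryTetrahedral) :
    (2 * x.re) ^ 2 = 0 ∨ (2 * x.re) ^ 2 = 1 ∨ (2 * x.re) ^ 2 = 4 := by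
  obtain ⟨a, ha, q, hq, rfl⟩ := mem_binaryTetrahedral.1 hx
  interval_cases a
  · rcases sq_re_of_mem_Q8 hq with h | h <;> simp [h]
  all_goals
    refine .inr (.inl ?_)
    rcases mem_Q8.1 hq with rfl | rfl | rfl | rfl | rfl | rfl | rfl | rfl <;>
      norm_num

open Classical in
lemma sum_binaryTetrahedral (x : ℍ[ℝ]) (n : ℕ) :
    ∑ t ∈ binaryTetrahedral, chebU (x * t).re (2 * n) =
      cosetSum x n + cosetSum (x * omega) n + cosetSum (x * omega ^ 2) n := by
  have hω : ∀ s ∈ Q8, omega ≠ s := by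
    rintro s hs rfl
    have := sq_re_of_mem_Q8 hs
    norm_num at this
  have hω2 : ∀ s ∈ Q8, omega ^ 2 ≠ s := by
    rintro s hs rfl
    have := sq_re_of_mem_Q8 hs
    norm_num at this
  have d1 : Disjoint Q8 (translate omega Q8) := by
    simpa only [translate_one] using isUnitGroup_Q8.disjoint_translate (x := 1) (y := omega)
      fun s hs h => hω s hs (by simpa using h.symm)
  have d2 : Disjoint Q8 (translate (omega ^ 2) Q8) := by
    simpa only [translate_one] using isUnitGroup_Q8.disjoint_translate (x := 1) (y := omega ^ 2)
      fun s hs h => hω2 s hs (by simpa using h.symm)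
  have d3 : Disjoint (translate omega Q8) (translate (omega ^ 2) Q8) :=
    isUnitGroup_Q8.disjoint_translate fun s hs h =>
      hω s hs (mul_left_cancel₀ omega_ne_zero (by rw [h, pow_two]))
  rw [binaryTetrahedral, Finset.sum_union (Finset.disjoint_union_left.2 ⟨d2, d3⟩),
    Finset.sum_union d1, sum_translate omega_ne_zero, sum_translate (pow_ne_zero 2 omega_ne_zero)]
  simp only [← mul_assoc, sum_Q8]

theorem T_binaryTetrahedral : T (toR4 binaryTetrahedral) = {10, 4, 2} ∪ oddPos := by
  ext l
  rcases Nat.even_or_odd' l with ⟨n, rfl | rfl⟩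
  · have h1 : ∑ t ∈ binaryTetrahedral, chebU t.re (2 * n) =
        2 * (evenU 4 n + 3 * evenU 0 n + 8 * evenU 1 n) := by
      have := sum_binaryTetrahedral 1 n
      simp only [one_mul] at this
      rw [this, cosetSum_eq (x := 1) (a := 4) (b := 0) (c := 0) (d := 0),
        cosetSum_eq (x := omega) (a := 1) (b := 1) (c := 1) (d := 1),
        cosetSum_eq (x := omega ^ 2) (a := 1) (b := 1) (c := 1) (d := 1)]
      · ring
      all_goals norm_num
    rw [isUnitGroup_binaryTetrahedral.mem_T_iff, h1, evenU_four, evenU_zero, evenU_one]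
    have hodd : ¬ Odd (2 * n) := by simp
    simp only [oddPos, Set.mem_union, Set.mem_insert_iff, Set.mem_singleton_iff, Set.mem_ofPred_eq,
      hodd, or_false]
    norm_cast
    -- Each branch fixes n mod 2 and mod 3; a solution needs 2n + 1 ≤ 3 + 8.
    split_ifs <;> omega
  · have hodd : Odd (2 * n + 1) := ⟨n, rfl⟩
    exact iff_of_true (isUnitGroup_binaryTetrahedral.mem_T_of_odd
      (Q8_subset_binaryTetrahedral neg_one_mem_Q8) hodd) (.inr hodd)

end Tetrahedral

/-! ### Groups assembled from cosets of 2T. -/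

section Cosets

/-- The union of the cosets `ξᵃ 2T` for `a < N` is a group of unit quaternions if `ξ^N ∈ 2T` and
left multiplication by the generators of `2T` permutes these cosets. -/
lemma isUnitGroup_of_cosets {G : Finset ℍ[ℝ]} {ξ : ℍ[ℝ]} {N : ℕ} (hN : 0 < N)
    (hG : ∀ x, x ∈ G ↔ ∃ a < N, ∃ t ∈ binaryTetrahedral, ξ ^ a * t = x)
    (hξ : star ξ * ξ = 1) (hξN : ξ ^ N ∈ binaryTetrahedral)
    (hi : ∀ a < N, ∃ b < N, ∃ t ∈ binaryTetrahedral, qi * ξ ^ a = ξ ^ b * t)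
    (hω : ∀ a < N, ∃ b < N, ∃ t ∈ binaryTetrahedral, omega * ξ ^ a = ξ ^ b * t) :
    IsUnitGroup G := by
  have hT := isUnitGroup_binaryTetrahedral
  have hstab : ∀ g : ℍ[ℝ], (∀ a < N, ∃ b < N, ∃ t ∈ binaryTetrahedral, g * ξ ^ a = ξ ^ b * t) →
      g ∈ leftStabilizer G := by
    intro g hg y hy
    obtain ⟨a, ha, t, ht, rfl⟩ := (hG y).1 hy
    obtain ⟨b, hb, s, hs, h⟩ := hg a ha
    exact (hG _).2 ⟨b, hb, s * t, hT.mul_mem _ hs _ ht, by rw [← mul_assoc, ← mul_assoc, h]⟩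
  -- Multiplication by ξ shifts the cosets, and ξ^N ∈ 2T sends the last one back to 2T.
  have hξmem : ξ ∈ leftStabilizer G := hstab ξ fun a ha => by
    rcases Nat.lt_or_ge (a + 1) N with h | h
    · exact ⟨a + 1, h, 1, hT.one_mem, by rw [mul_one, pow_succ']⟩
    · obtain rfl : N = a + 1 := by omega
      exact ⟨0, hN, ξ ^ (a + 1), hξN, by rw [pow_zero, one_mul, pow_succ']⟩
  refine ⟨(hG 1).2 ⟨0, hN, 1, hT.one_mem, by simp⟩, fun x hx => ?_, fun x hx => ?_⟩
  · obtain ⟨a, -, t, ht, rfl⟩ := (hG x).1 hx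
    exact mem_leftStabilizer.1 (Submonoid.mul_mem _ (Submonoid.pow_mem _ hξmem a)
      (binaryTetrahedral_subset (hstab _ hi) (hstab _ hω) ht))
  · obtain ⟨a, -, t, ht, rfl⟩ := (hG x).1 hx
    exact star_mul_self_of_mul (unitQuaternions.pow_mem hξ a) (hT.star_mul_self t ht)

lemma disjoint_translate_pow {ξ : ℍ[ℝ]} (hξ : ξ ≠ 0) {a b : ℕ} (hab : a ≤ b)
    (h : ξ ^ (b - a) ∉ binaryTetrahedral) :
    Disjoint (translate (ξ ^ a) binaryTetrahedral) (translate (ξ ^ b) binaryTetrahedral) := by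
  refine isUnitGroup_binaryTetrahedral.disjoint_translate fun s hs hsb => h ?_
  rw [← Nat.add_sub_cancel' hab, pow_add] at hsb
  exact mul_left_cancel₀ (pow_ne_zero a hξ) hsb ▸ hs

lemma neg_mem_binaryTetrahedral {x : ℍ[ℝ]} (hx : x ∈ binaryTetrahedral) :
    -x ∈ binaryTetrahedral := by
  simpa using isUnitGroup_binaryTetrahedral.mul_mem _
    (Q8_subset_binaryTetrahedral neg_one_mem_Q8) _ hx

end Cosets

/-! ### The binary octahedral group. -/

section Octahedral

lemma one_div_sqrt_two_mul_self : 1 / √2 * (1 / √2) = 1 / 2 := by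
  rw [div_mul_div_comm, one_mul, Real.mul_self_sqrt (by norm_num)]

lemma alpha_re : alpha.re = 1 / √2 := rfl
lemma alpha_imI : alpha.imI = 1 / √2 := rfl
lemma alpha_imJ : alpha.imJ = 0 := rfl
lemma alpha_imK : alpha.imK = 0 := rfl

lemma alpha_sq : alpha ^ 2 = qi := by
  have h := one_div_sqrt_two_mul_self
  rw [pow_two]
  ext <;> simp only [Quaternion.re_mul, Quaternion.imI_mul, Quaternion.imJ_mul, Quaternion.imK_mul,
    alpha_re, alpha_imI, alpha_imJ, alpha_imK, h, qi_re, qi_imI, qi_imJ, qi_imK] <;> norm_num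

lemma star_alpha_mul_self : star alpha * alpha = 1 := by
  have h := one_div_sqrt_two_mul_self
  ext <;> simp only [Quaternion.re_mul, Quaternion.imI_mul, Quaternion.imJ_mul, Quaternion.imK_mul,
    Quaternion.re_star, Quaternion.imI_star, Quaternion.imJ_star, Quaternion.imK_star,
    alpha_re, alpha_imI, alpha_imJ, alpha_imK, neg_mul, h] <;> norm_num

lemma alpha_ne_zero : alpha ≠ 0 := fun h => by simpa [h] using star_alpha_mul_self

lemma qi_mul_alpha : qi * alpha = alpha * qi := by
  rw [← alpha_sq, pow_two, mul_assoc]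

lemma omega_mul_alpha : omega * alpha = alpha * -(omega ^ 2 * qi) := by
  ext <;> simp [alpha_re, alpha_imI, alpha_imJ, alpha_imK] <;> ring

open Classical in
lemma mem_binaryOctahedral (x : ℍ[ℝ]) :
    x ∈ binaryOctahedral ↔ ∃ a < 2, ∃ t ∈ binaryTetrahedral, alpha ^ a * t = x := by
  rw [binaryOctahedral, Finset.mem_union, mem_translate]
  constructor
  · rintro (h | ⟨t, ht, h⟩)
    exacts [⟨0, by norm_num, x, h, by simp⟩, ⟨1, by norm_num, t, ht, by simpa using h⟩]
  · rintro ⟨a, ha, t, ht, h⟩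
    interval_cases a
    exacts [.inl (by simpa [← h] using ht), .inr ⟨t, ht, by simpa using h⟩]

lemma isUnitGroup_binaryOctahedral : IsUnitGroup binaryOctahedral := by
  refine isUnitGroup_of_cosets (ξ := alpha) (N := 2) (by norm_num) mem_binaryOctahedral
    star_alpha_mul_self (alpha_sq ▸ Q8_subset_binaryTetrahedral qi_mem_Q8) ?_ ?_
  · intro a ha
    refine ⟨a, ha, qi, Q8_subset_binaryTetrahedral qi_mem_Q8, ?_⟩
    interval_cases a <;> simp [qi_mul_alpha]
  · intro a ha
    interval_cases a
    · exact ⟨0, ha, omega, omega_mem_binaryTetrahedral, by simp⟩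
    · exact ⟨1, ha, _, neg_mem_binaryTetrahedral (omega_pow_mul_mem qi_mem_Q8 2),
        by simpa using omega_mul_alpha⟩

lemma alpha_notMem_binaryTetrahedral : alpha ∉ binaryTetrahedral := by
  intro h
  have h2 : (2 * alpha.re) ^ 2 = 2 := by
    rw [alpha_re]
    linear_combination 4 * one_div_sqrt_two_mul_self
  have := sq_re_of_mem_binaryTetrahedral h
  norm_num [h2] at this

-- The coset α 2T adds 12 elements of real part 0 and 12 of real part ±1/√2 to those of 2T.
open Classical in
lemma sum_binaryOctahedral (n : ℕ) :
    ∑ g ∈ binaryOctahedral, chebU g.re (2 * n) =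
      2 * (evenU 4 n + 9 * evenU 0 n + 8 * evenU 1 n + 6 * evenU 2 n) := by
  have hd : Disjoint binaryTetrahedral (translate alpha binaryTetrahedral) := by
    simpa [translate_one] using disjoint_translate_pow alpha_ne_zero (a := 0) (b := 1)
      (by norm_num) (by simpa using alpha_notMem_binaryTetrahedral)
  have h1 := sum_binaryTetrahedral 1 n
  simp only [one_mul] at h1
  have h := one_div_sqrt_two_mul_self
  rw [binaryOctahedral, Finset.sum_union hd, sum_translate alpha_ne_zero, sum_binaryTetrahedral,
    h1, cosetSum_eq (x := 1) (a := 4) (b := 0) (c := 0) (d := 0),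
    cosetSum_eq (x := omega) (a := 1) (b := 1) (c := 1) (d := 1),
    cosetSum_eq (x := omega ^ 2) (a := 1) (b := 1) (c := 1) (d := 1),
    cosetSum_eq (x := alpha) (a := 2) (b := 2) (c := 0) (d := 0),
    cosetSum_eq (x := alpha * omega) (a := 2) (b := 0) (c := 0) (d := 2),
    cosetSum_eq (x := alpha * omega ^ 2) (a := 0) (b := 2) (c := 0) (d := 2)]
  · ring
  all_goals
    simp only [Quaternion.re_mul, Quaternion.imI_mul, Quaternion.imJ_mul, Quaternion.imK_mul,
      alpha_re, alpha_imI, alpha_imJ, alpha_imK, omega_re, omega_imI, omega_imJ, omega_imK,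
      omega_sq_re, omega_sq_imI, omega_sq_imJ, omega_sq_imK, Quaternion.re_one, Quaternion.imI_one,
      Quaternion.imJ_one, Quaternion.imK_one]
    first | norm_num; done | linear_combination 4 * h

theorem T_binaryOctahedral : T (toR4 binaryOctahedral) = {22, 14, 10, 6, 4, 2} ∪ oddPos := by
  ext l
  rcases Nat.even_or_odd' l with ⟨n, rfl | rfl⟩
  · rw [isUnitGroup_binaryOctahedral.mem_T_iff, sum_binaryOctahedral, evenU_four, evenU_zero,
      evenU_one, evenU_two]
    have hodd : ¬ Odd (2 * n) := by simp
    simp only [oddPos, Set.mem_union, Set.mem_insert_iff, Set.mem_singleton_iff, Set.mem_ofPred_eq,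
      hodd, or_false]
    norm_cast
    split_ifs <;> omega
  · have hodd : Odd (2 * n + 1) := ⟨n, rfl⟩
    refine iff_of_true (isUnitGroup_binaryOctahedral.mem_T_of_odd ?_ hodd) (.inr hodd)
    exact (mem_binaryOctahedral _).2
      ⟨0, by norm_num, -1, Q8_subset_binaryTetrahedral neg_one_mem_Q8, by simp⟩

end Octahedral

/-! ### The binary icosahedral group. -/

section Icosahedral

@[simp] lemma zeta_re : zeta.re = tau / 2 := rfl
@[simp] lemma zeta_imI : zeta.imI = (tau - 1) / 2 := by rw [← tau_inv]; rfl
@[simp] lemma zeta_imJ : zeta.imJ = 1 / 2 := rfl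
@[simp] lemma zeta_imK : zeta.imK = 0 := rfl

lemma zeta_sq : (zeta ^ 2).re = (tau - 1) / 2 ∧ (zeta ^ 2).imI = 1 / 2 ∧
    (zeta ^ 2).imJ = tau / 2 ∧ (zeta ^ 2).imK = 0 := by
  have h := tau_sq
  simp only [pow_two, Quaternion.re_mul, Quaternion.imI_mul, Quaternion.imJ_mul,
    Quaternion.imK_mul, zeta_re, zeta_imI, zeta_imJ, zeta_imK]
  exact ⟨by ring, by linear_combination h / 2, by ring, by ring⟩

@[simp] lemma zeta_sq_re : (zeta ^ 2).re = (tau - 1) / 2 := zeta_sq.1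
@[simp] lemma zeta_sq_imI : (zeta ^ 2).imI = 1 / 2 := zeta_sq.2.1
@[simp] lemma zeta_sq_imJ : (zeta ^ 2).imJ = tau / 2 := zeta_sq.2.2.1
@[simp] lemma zeta_sq_imK : (zeta ^ 2).imK = 0 := zeta_sq.2.2.2

lemma zeta_cube : (zeta ^ 3).re = (1 - tau) / 2 ∧ (zeta ^ 3).imI = 1 / 2 ∧
    (zeta ^ 3).imJ = tau / 2 ∧ (zeta ^ 3).imK = 0 := by
  have h := tau_sq
  simp only [pow_succ zeta 2, Quaternion.re_mul, Quaternion.imI_mul, Quaternion.imJ_mul,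
    Quaternion.imK_mul, zeta_re, zeta_imI, zeta_imJ, zeta_imK, zeta_sq_re, zeta_sq_imI,
    zeta_sq_imJ, zeta_sq_imK]
  exact ⟨by linear_combination h / 4, by linear_combination h / 4, by linear_combination h / 4,
    by linear_combination -h / 4⟩

@[simp] lemma zeta_cube_re : (zeta ^ 3).re = (1 - tau) / 2 := zeta_cube.1
@[simp] lemma zeta_cube_imI : (zeta ^ 3).imI = 1 / 2 := zeta_cube.2.1
@[simp] lemma zeta_cube_imJ : (zeta ^ 3).imJ = tau / 2 := zeta_cube.2.2.1
@[simp] lemma zeta_cube_imK : (zeta ^ 3).imK = 0 := zeta_cube.2.2.2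

lemma zeta_pow_four : (zeta ^ 4).re = -tau / 2 ∧ (zeta ^ 4).imI = (tau - 1) / 2 ∧
    (zeta ^ 4).imJ = 1 / 2 ∧ (zeta ^ 4).imK = 0 := by
  have h := tau_sq
  simp only [pow_succ zeta 3, Quaternion.re_mul, Quaternion.imI_mul, Quaternion.imJ_mul,
    Quaternion.imK_mul, zeta_re, zeta_imI, zeta_imJ, zeta_imK, zeta_cube_re, zeta_cube_imI,
    zeta_cube_imJ, zeta_cube_imK]
  exact ⟨by linear_combination -h / 4, by linear_combination -h / 4, by linear_combination h / 4,
    by linear_combination -h / 4⟩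

@[simp] lemma zeta_pow_four_re : (zeta ^ 4).re = -tau / 2 := zeta_pow_four.1
@[simp] lemma zeta_pow_four_imI : (zeta ^ 4).imI = (tau - 1) / 2 := zeta_pow_four.2.1
@[simp] lemma zeta_pow_four_imJ : (zeta ^ 4).imJ = 1 / 2 := zeta_pow_four.2.2.1
@[simp] lemma zeta_pow_four_imK : (zeta ^ 4).imK = 0 := zeta_pow_four.2.2.2

lemma zeta_pow_five : zeta ^ 5 = -1 := by
  have h := tau_sq
  rw [pow_succ]
  ext <;> simp only [Quaternion.re_mul, Quaternion.imI_mul, Quaternion.imJ_mul, Quaternion.imK_mul,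
    zeta_re, zeta_imI, zeta_imJ, zeta_imK, zeta_pow_four_re, zeta_pow_four_imI, zeta_pow_four_imJ,
    zeta_pow_four_imK, Quaternion.re_neg, Quaternion.imI_neg, Quaternion.imJ_neg,
    Quaternion.imK_neg, Quaternion.re_one, Quaternion.imI_one, Quaternion.imJ_one,
    Quaternion.imK_one]
  · linear_combination -h / 2
  all_goals ring

lemma star_zeta_mul_self : star zeta * zeta = 1 := by
  have h := tau_sq
  ext <;> simp only [Quaternion.re_mul, Quaternion.imI_mul, Quaternion.imJ_mul, Quaternion.imK_mul,
    Quaternion.re_star, Quaternion.imI_star, Quaternion.imJ_star, Quaternion.imK_star,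
    zeta_re, zeta_imI, zeta_imJ, zeta_imK, Quaternion.re_one, Quaternion.imI_one,
    Quaternion.imJ_one, Quaternion.imK_one]
  · linear_combination h / 2
  all_goals ring

lemma zeta_ne_zero : zeta ≠ 0 := fun h => by simpa [h] using star_zeta_mul_self

/-- In this and the next seven identities the generators of 2T permute the five cosets ζᵃ 2T: i acts
as (1 3)(2 4), ω as (1 2 4). All coordinates are linear in τ, so `tau_sq` is not needed. -/
lemma qi_mul_zeta : qi * zeta = zeta ^ 3 * -(omega * qk) := by
  ext <;> simp <;> ring
lemma qi_mul_zeta_sq : qi * zeta ^ 2 = zeta ^ 4 * (omega ^ 2 * qk) := by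
  ext <;> simp <;> ring
lemma qi_mul_zeta_cube : qi * zeta ^ 3 = zeta * -(omega ^ 2 * qj) := by
  ext <;> simp <;> ring
lemma qi_mul_zeta_pow_four : qi * zeta ^ 4 = zeta ^ 2 * (omega * qi) := by
  ext <;> simp <;> ring
lemma omega_mul_zeta : omega * zeta = zeta ^ 2 * qj := by
  ext <;> simp <;> ring
lemma omega_mul_zeta_sq : omega * zeta ^ 2 = zeta ^ 4 * -(omega * qj) := by
  ext <;> simp <;> ring
lemma omega_mul_zeta_cube : omega * zeta ^ 3 = zeta ^ 3 * -(omega ^ 2 * qi) := by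
  ext <;> simp <;> ring
lemma omega_mul_zeta_pow_four : omega * zeta ^ 4 = zeta * omega ^ 2 := by
  ext <;> simp <;> ring

open Classical in
lemma mem_binaryIcosahedral (x : ℍ[ℝ]) :
    x ∈ binaryIcosahedral ↔ ∃ a < 5, ∃ t ∈ binaryTetrahedral, zeta ^ a * t = x := by
  simp only [binaryIcosahedral, Finset.mem_union, mem_translate]
  constructor
  · rintro ((((h | ⟨t, ht, h⟩) | ⟨t, ht, h⟩) | ⟨t, ht, h⟩) | ⟨t, ht, h⟩)
    exacts [⟨0, by norm_num, x, h, by simp⟩, ⟨1, by norm_num, t, ht, by simpa using h⟩,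
      ⟨2, by norm_num, t, ht, h⟩, ⟨3, by norm_num, t, ht, h⟩, ⟨4, by norm_num, t, ht, h⟩]
  · rintro ⟨a, ha, t, ht, h⟩
    interval_cases a
    exacts [.inl (.inl (.inl (.inl (by simpa [← h] using ht)))),
      .inl (.inl (.inl (.inr ⟨t, ht, by simpa using h⟩))), .inl (.inl (.inr ⟨t, ht, h⟩)),
      .inl (.inr ⟨t, ht, h⟩), .inr ⟨t, ht, h⟩]

lemma isUnitGroup_binaryIcosahedral : IsUnitGroup binaryIcosahedral := by
  have hω : ∀ {q : ℍ[ℝ]}, q ∈ Q8 → omega * q ∈ binaryTetrahedral := fun hq => by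
    simpa using omega_pow_mul_mem hq 1
  have hω2 : ∀ {q : ℍ[ℝ]}, q ∈ Q8 → omega ^ 2 * q ∈ binaryTetrahedral := fun hq =>
    omega_pow_mul_mem hq 2
  refine isUnitGroup_of_cosets (ξ := zeta) (N := 5) (by norm_num) mem_binaryIcosahedral
    star_zeta_mul_self (zeta_pow_five ▸ Q8_subset_binaryTetrahedral neg_one_mem_Q8) ?_ ?_ <;>
  intro a ha <;> interval_cases a
  · exact ⟨0, by norm_num, qi, Q8_subset_binaryTetrahedral qi_mem_Q8, by simp⟩
  · exact ⟨3, by norm_num, _, neg_mem_binaryTetrahedral (hω qk_mem_Q8),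
      by simpa using qi_mul_zeta⟩
  · exact ⟨4, by norm_num, _, hω2 qk_mem_Q8, qi_mul_zeta_sq⟩
  · exact ⟨1, by norm_num, _, neg_mem_binaryTetrahedral (hω2 qj_mem_Q8),
      by simpa using qi_mul_zeta_cube⟩
  · exact ⟨2, by norm_num, _, hω qi_mem_Q8, qi_mul_zeta_pow_four⟩
  · exact ⟨0, by norm_num, omega, omega_mem_binaryTetrahedral, by simp⟩
  · exact ⟨2, by norm_num, _, Q8_subset_binaryTetrahedral qj_mem_Q8,
      by simpa using omega_mul_zeta⟩
  · exact ⟨4, by norm_num, _, neg_mem_binaryTetrahedral (hω qj_mem_Q8), omega_mul_zeta_sq⟩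
  · exact ⟨3, by norm_num, _, neg_mem_binaryTetrahedral (hω2 qi_mem_Q8), omega_mul_zeta_cube⟩
  · exact ⟨1, by norm_num, _, by simpa using hω2 isUnitGroup_Q8.one_mem,
      by simpa using omega_mul_zeta_pow_four⟩

/-- Sharp enough to separate τ + 1 and 2 - τ from 0, 1 and 4. -/
lemma tau_bounds : 3 / 2 < tau ∧ tau < 2 := by
  have h2 : (2 : ℝ) < √5 := Real.lt_sqrt_of_sq_lt (by norm_num)
  have h3 : √5 < 3 := (Real.sqrt_lt' (by norm_num)).2 (by norm_num)
  rw [tau]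
  constructor <;> linarith

lemma zeta_pow_notMem_binaryTetrahedral {k : ℕ} (h0 : 0 < k) (h5 : k < 5) :
    zeta ^ k ∉ binaryTetrahedral := by
  intro hmem
  obtain ⟨hl, hu⟩ := tau_bounds
  have h : (2 * (zeta ^ k).re) ^ 2 = tau + 1 ∨ (2 * (zeta ^ k).re) ^ 2 = 2 - tau := by
    interval_cases k
    · left; rw [pow_one, zeta_re]; linear_combination tau_sq
    · right; rw [zeta_sq_re]; linear_combination tau_sq
    · right; rw [zeta_cube_re]; linear_combination tau_sq
    · left; rw [zeta_pow_four_re]; linear_combination tau_sq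
  rcases h with h | h <;> rcases sq_re_of_mem_binaryTetrahedral hmem with h' | h' | h' <;> linarith

open Classical in
lemma sum_binaryIcosahedral_eq_sum_cosets (f : ℍ[ℝ] → ℝ) :
    ∑ g ∈ binaryIcosahedral, f g =
      ∑ a ∈ Finset.range 5, ∑ t ∈ binaryTetrahedral, f (zeta ^ a * t) := by
  have hG : binaryIcosahedral =
      (Finset.range 5).biUnion fun a => translate (zeta ^ a) binaryTetrahedral := by
    ext x
    simp [mem_binaryIcosahedral, mem_translate]
  have key : ∀ a b : ℕ, b < 5 → a < b → Disjoint (translate (zeta ^ a) binaryTetrahedral)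
      (translate (zeta ^ b) binaryTetrahedral) := fun a b hb hab =>
    disjoint_translate_pow zeta_ne_zero hab.le
      (zeta_pow_notMem_binaryTetrahedral (by omega) (by omega))
  rw [hG, Finset.sum_biUnion]
  · exact Finset.sum_congr rfl fun a _ => sum_translate (pow_ne_zero a zeta_ne_zero) _ _
  · intro a ha b hb hab
    have ha' := Finset.mem_range.1 ha
    have hb' := Finset.mem_range.1 hb
    rcases Nat.lt_or_gt_of_ne hab with h | h
    exacts [key a b hb' h, (key b a ha' h).symm]

/-- Each of the four cosets outside 2T has six elements for each squared trace 0, 1, τ + 1, 2 - τ.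
-/
lemma sum_binaryIcosahedral (n : ℕ) :
    ∑ g ∈ binaryIcosahedral, chebU g.re (2 * n) =
      2 * (evenU 4 n + 15 * evenU 0 n + 20 * evenU 1 n +
        12 * (evenU (tau + 1) n + evenU (2 - tau) n)) := by
  have h := tau_sq
  rw [sum_binaryIcosahedral_eq_sum_cosets]
  simp only [sum_binaryTetrahedral, Finset.sum_range_succ, Finset.sum_range_zero, zero_add,
    pow_zero, pow_one, one_mul]
  rw [cosetSum_eq (x := 1) (a := 4) (b := 0) (c := 0) (d := 0),
    cosetSum_eq (x := omega) (a := 1) (b := 1) (c := 1) (d := 1),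
    cosetSum_eq (x := omega ^ 2) (a := 1) (b := 1) (c := 1) (d := 1),
    cosetSum_eq (x := zeta) (a := tau + 1) (b := 2 - tau) (c := 1) (d := 0),
    cosetSum_eq (x := zeta * omega) (a := tau + 1) (b := 1) (c := 0) (d := 2 - tau),
    cosetSum_eq (x := zeta * omega ^ 2) (a := 0) (b := tau + 1) (c := 1) (d := 2 - tau),
    cosetSum_eq (x := zeta ^ 2) (a := 2 - tau) (b := 1) (c := tau + 1) (d := 0),
    cosetSum_eq (x := zeta ^ 2 * omega) (a := tau + 1) (b := 2 - tau) (c := 1) (d := 0),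
    cosetSum_eq (x := zeta ^ 2 * omega ^ 2) (a := 1) (b := tau + 1) (c := 2 - tau) (d := 0),
    cosetSum_eq (x := zeta ^ 3) (a := 2 - tau) (b := 1) (c := tau + 1) (d := 0),
    cosetSum_eq (x := zeta ^ 3 * omega) (a := 1) (b := 0) (c := tau + 1) (d := 2 - tau),
    cosetSum_eq (x := zeta ^ 3 * omega ^ 2) (a := tau + 1) (b := 1) (c := 0) (d := 2 - tau),
    cosetSum_eq (x := zeta ^ 4) (a := tau + 1) (b := 2 - tau) (c := 1) (d := 0),
    cosetSum_eq (x := zeta ^ 4 * omega) (a := 0) (b := 2 - tau) (c := tau + 1) (d := 1),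
    cosetSum_eq (x := zeta ^ 4 * omega ^ 2) (a := tau + 1) (b := 0) (c := 2 - tau) (d := 1)]
  · ring
  all_goals
    simp only [Quaternion.re_mul, Quaternion.imI_mul, Quaternion.imJ_mul, Quaternion.imK_mul,
      omega_re, omega_imI, omega_imJ, omega_imK, omega_sq_re, omega_sq_imI, omega_sq_imJ,
      omega_sq_imK, zeta_re, zeta_imI, zeta_imJ, zeta_imK, zeta_sq_re, zeta_sq_imI, zeta_sq_imJ,
      zeta_sq_imK, zeta_cube_re, zeta_cube_imI, zeta_cube_imJ, zeta_cube_imK, zeta_pow_four_re,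
      zeta_pow_four_imI, zeta_pow_four_imJ, zeta_pow_four_imK, Quaternion.re_one,
      Quaternion.imI_one, Quaternion.imJ_one, Quaternion.imK_one]
    first | ring1 | linear_combination h

theorem T_binaryIcosahedral : T (toR4 binaryIcosahedral) =
    {58, 46, 38, 34, 28, 26, 22, 18, 16, 14, 10, 8, 6, 4, 2} ∪ oddPos := by
  ext l
  rcases Nat.even_or_odd' l with ⟨n, rfl | rfl⟩
  · rw [isUnitGroup_binaryIcosahedral.mem_T_iff, sum_binaryIcosahedral, evenU_four, evenU_zero,
      evenU_one, evenU_tau_add_conj]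
    have hodd : ¬ Odd (2 * n) := by simp
    simp only [oddPos, Set.mem_union, Set.mem_insert_iff, Set.mem_singleton_iff, Set.mem_ofPred_eq,
      hodd, or_false]
    norm_cast
    -- The branches fix n mod 2, 3 and 5; a solution needs 2n + 1 ≤ 15 + 20 + 24 = 59, attained at n
    -- = 29, the degree 58.
    split_ifs <;> omega
  · have hodd : Odd (2 * n + 1) := ⟨n, rfl⟩
    refine iff_of_true (isUnitGroup_binaryIcosahedral.mem_T_of_odd ?_ hodd) (.inr hodd)
    exact (mem_binaryIcosahedral _).2
      ⟨0, by norm_num, -1, Q8_subset_binaryTetrahedral neg_one_mem_Q8, by simp⟩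

end Icosahedral

end

end HarmonicStrength

theorem mainTheorem1 :
    HarmonicStrength.T (HarmonicStrength.toR4 HarmonicStrength.binaryTetrahedral) =
        {10, 4, 2} ∪ HarmonicStrength.oddPos ∧
      HarmonicStrength.T (HarmonicStrength.toR4 HarmonicStrength.binaryOctahedral) =
        {22, 14, 10, 6, 4, 2} ∪ HarmonicStrength.oddPos ∧
      HarmonicStrength.T (HarmonicStrength.toR4 HarmonicStrength.binaryIcosahedral) =
        {58, 46, 38, 34, 28, 26, 22, 18, 16, 14, 10, 8, 6, 4, 2} ∪ HarmonicStrength.oddPos :=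
  ⟨HarmonicStrength.T_binaryTetrahedral, HarmonicStrength.T_binaryOctahedral,
    HarmonicStrength.T_binaryIcosahedral⟩
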